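/- **Setting.** A resource allocation game has finitely many agents $1,\dots,n$, a finite set $\mathcal R$ of resources, and for each agent $i$ a nonempty set $\mathcal A_i\subseteq 2^{\mathcal R}$ of actions. For a profile $a=(a_1,\dots,a_n)$ let $|a|_r$ be the number of agents $i$ with $r\in a_i$. Every resource $r$ has a welfare rule $w_r:\mathbb N\to\mathbb R$ and a utility rule $f_r:\mathbb N\to\mathbb R_{\ge0}$; the system welfare is $W(a)=\sum_{r\in\bigcup_i a_i}w_r(|a|_r)$ and agent $i$ has utility $U_i(a)=\sum_{r\in a_i}f_r(|a|_r)$. In a one-round walk all agents start at the null action $\varnothing$, and agents $1,\dots,n$ move once each, in this order, each to an arbitrary best response in $\mathcal A_i$ to the current actions of the others; $\mathrm{sol}(1)$ is the set of all possible outcomes. The efficiency of a game $G$ is $\mathrm{Eff}(G;1)=\min_{a\in\mathrm{sol}(1)}W(a)\,/\max_{a\in\mathcal A_1\times\dots\times\mathcal A_n}W(a)$. For a set $\mathcal W$ of welfare rules and a utility design $\mathcal U:\mathcal W\to\mathbb R_{\ge0}^{\mathbb N}$, let $\mathrm{Eff}(\mathcal W,\mathcal U;1)$ be the infimum of $\mathrm{Eff}(G;1)$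 over all games (with positive maximal welfare) such that $w_r\in\mathcal W$ and $f_r=\mathcal U(w_r)$ for all $r$, and let $\mathrm{Eff}^*(\mathcal W;1)=\sup_{\mathcal U}\mathrm{Eff}(\mathcal W,\mathcal U;1)$. **Theorem.** Let $m\ge1$ and let $w^1,\dots,w^m$ be submodular welfare rules, i.e. $w^\ell(j+1)\ge w^\ell(j)$ and $w^\ell(j+1)-w^\ell(j)$ is nonincreasing in $j\ge0$, normalized by $w^\ell(0)=0$ and $w^\ell(1)=1$. Let $\mathcal W=\{\sum_\ell\alpha^\ell w^\ell:\alpha^1,\dots,\alpha^m\ge0\}$. For each $\ell$ consider the linear program: minimize $\beta$ over $\beta\ge0$ and $f\in\mathbb R_{\ge0}^{\mathbb N}$ with $f(1)=1$, subject to $$\beta\, w^\ell(y)\ \ge\ \sum_{i=1}^{y}f(i)-z\,f(y+1)+w^\ell(z)\qquad\text{for all integers } y\ge1,\ z\ge0 .$$ Its minimum $\beta^\ell$ is attained, is positive, and is attained by some $f$ that is nonincreasing on $\{1,2,\dots\}$. Moreover $$\mathrm{Eff}^*(\mathcal W;1)=\min_{1\le\ell\le m}\frac1{\beta^\ell}.$$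 Finally, let $u^\ell$, for each $\ell$, be any nonincreasing optimal solution of the $\ell$-th program. Then every utility design of the linear form $\mathcal U\big(\sum_\ell\alpha^\ell w^\ell\big)=\sum_\ell\alpha^\ell u^\ell$ (with one arbitrary representation $\sum_\ell\alpha^\ell w^\ell$, $\alpha^\ell\ge0$, chosen for each $w\in\mathcal W$ if the $w^\ell$ are linearly dependent) attains the optimum: $\mathrm{Eff}(\mathcal W,\mathcal U;1)=\mathrm{Eff}^*(\mathcal W;1)$. -/

import Mathlib

open scoped NNReal

namespace ResourceGame

/-- A welfare rule; `w j` is the welfare of a resource used by `j` agents. -/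
abbrev WelfareRule : Type := ℕ → ℝ

/-- A (nonnegative) utility rule; `f j` is what each of the `j` users of a resource gets. The value
`f 0` is never used. -/
abbrev UtilityRule : Type := ℕ → ℝ≥0

/-- The rule is nondecreasing and has nonincreasing marginal returns. -/
def IsSubmodular (w : WelfareRule) : Prop :=
  (∀ j, w j ≤ w (j + 1)) ∧ Antitone fun j => w (j + 1) - w j

/-- All nonnegative combinations of the basis rules. -/
def spanned {m : ℕ} (w : Fin m → WelfareRule) : Set WelfareRule :=
  {v | ∃ α : Fin m → ℝ≥0, v = ∑ l, (α l : ℝ) • w l}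

/-- A utility design assigns a utility rule to every welfare rule of the class. -/
abbrev UtilityDesign (𝒲 : Set WelfareRule) : Type := 𝒲 → UtilityRule

/-- A resource allocation game with agents `Fin n` and resources `Fin c`. -/
structure Game where
  /-- number of agents -/
  n : ℕ
  /-- number of resources -/
  c : ℕ
  /-- the action set of each agent: a nonempty finite set of sets of resources -/
  actions : Fin n → Finset (Finset (Fin c))
  actions_nonempty : ∀ i, (actions i).Nonempty
  /-- the welfare rule of each resource -/
  w : Fin c → WelfareRule
  /-- the utility rule of each resource -/
  f : Fin c → UtilityRule

namespace Game

/-- A choice of a set of resources for every agent (including the null profile, and not necessarily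
made of available actions). -/
abbrev Profile (G : Game) : Type := Fin G.n → Finset (Fin G.c)

/-- The joint actions of the game. -/
def jointActions (G : Game) : Set G.Profile := {a | ∀ i, a i ∈ G.actions i}

/-- The number of agents that use the resource `r`. -/
def load (G : Game) (a : G.Profile) (r : Fin G.c) : ℕ :=
  (Finset.univ.filter fun i => r ∈ a i).card

/-- The system welfare. -/
noncomputable def welfare (G : Game) (a : G.Profile) : ℝ :=
  ∑ r ∈ Finset.univ.biUnion a, G.w r (G.load a r)

/-- The utility of agent `i`. -/
noncomputable def utility (G : Game) (i : Fin G.n) (a : G.Profile) : ℝ :=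
  ∑ r ∈ a i, (G.f r (G.load a r) : ℝ)

/-- The best responses of agent `i` when the others play as in `a`. -/
def bestResponses (G : Game) (i : Fin G.n) (a : G.Profile) : Set (Finset (Fin G.c)) :=
  {b | b ∈ G.actions i ∧ ∀ b' ∈ G.actions i,
    G.utility i (Function.update a i b') ≤ G.utility i (Function.update a i b)}

/-- `a 0, a 1, …, a (k * n)` is a `k`-round walk: it starts at the null profile, and at time `τ` the
agent with index `τ mod n` (agents being numbered from `0`) moves to some best response. -/
def IsWalk (G : Game) (k : ℕ) (a : ℕ → G.Profile) : Prop :=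
  (a 0 = fun _ => ∅) ∧
    ∀ τ < k * G.n, ∀ i : Fin G.n, (i : ℕ) = τ % G.n →
      ∃ b ∈ G.bestResponses i (a τ), a (τ + 1) = Function.update (a τ) i b

/-- The possible outcomes of a `k`-round walk. -/
def sol (G : Game) (k : ℕ) : Set G.Profile := {s | ∃ a, G.IsWalk k a ∧ s = a (k * G.n)}

/-- The efficiency of the `k`-round walk: the worst welfare of an outcome over the best welfare
(extrema over finite nonempty sets when `1 ≤ k`). -/
noncomputable def efficiency (G : Game) (k : ℕ) : ℝ :=
  sInf (G.welfare '' G.sol k) / sSup (G.welfare '' G.jointActions)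

end Game

/-- The class of games induced by a set of welfare rules and a utility design. Games whose welfare
is not positive anywhere, for which the efficiency ratio is meaningless, are not in it. -/
def gameClass (𝒲 : Set WelfareRule) (𝒰 : UtilityDesign 𝒲) : Set Game :=
  {G | (∀ r, ∃ h : G.w r ∈ 𝒲, G.f r = 𝒰 ⟨G.w r, h⟩) ∧ ∃ a ∈ G.jointActions, 0 < G.welfare a}

/-- The guarantee of a design: the infimum of the `k`-round efficiency over its class of games. -/
noncomputable def classEfficiency (𝒲 : Set WelfareRule) (𝒰 : UtilityDesign 𝒲) (k : ℕ) : ℝ :=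
  sInf ((fun G : Game => G.efficiency k) '' gameClass 𝒲 𝒰)

/-- The optimal guarantee: the supremum over all utility designs. -/
noncomputable def optEfficiency (𝒲 : Set WelfareRule) (k : ℕ) : ℝ :=
  sSup (Set.range fun 𝒰 : UtilityDesign 𝒲 => classEfficiency 𝒲 𝒰 k)

/-- `(f, β)` is feasible for the linear program of the welfare rule `w`. -/
def LPFeasible (w : WelfareRule) (f : UtilityRule) (β : ℝ) : Prop :=
  0 ≤ β ∧ f 1 = 1 ∧
    ∀ y z : ℕ, 1 ≤ y →
      (∑ i ∈ Finset.Icc 1 y, (f i : ℝ)) - z * (f (y + 1) : ℝ) + w z ≤ β * w y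

/-- `(u, β)` is an optimal solution of the linear program of the welfare rule `w`. -/
def IsLPSolution (w : WelfareRule) (u : UtilityRule) (β : ℝ) : Prop :=
  LPFeasible w u β ∧ ∀ f β', LPFeasible w f β' → β ≤ β'

/-- The design sends `∑ α l • w l` to `∑ α l • u l`, with one (arbitrary) representation used for
each welfare rule of the class. If the basis is linearly independent, the representation is unique
and this is the linear design determined by `w l ↦ u l`. -/
def IsLinearDesign {m : ℕ} (w : Fin m → WelfareRule) (u : Fin m → UtilityRule)
    (𝒰 : UtilityDesign (spanned w)) : Prop :=
  ∀ v : spanned w, ∃ α : Fin m → ℝ≥0,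
    (v : WelfareRule) = ∑ l, (α l : ℝ) • w l ∧ 𝒰 v = ∑ l, α l • u l

end ResourceGame

namespace ResourceGame

/-! ### The linear program -/

section LinearProgram

variable {w : WelfareRule}

/-! Attainment and monotonicity. For fixed `β` the constraints with `z ≥ 1` bound `f (y + 1)` below
in terms of the excess `∑ f - β w y`, so there is a least rule, built greedily (`leastRule`), and
the constraint `z = 0` says that the excess is never positive. If that excess ever rose, it would
rise forever at a fixed rate; so it decreases, and the least rule decreases with it. Rules can
therefore be sought in `[0, 1]^ℕ`, and compactness yields the minimum.

Guarantee. Summing the best-response inequalities of a walk with outcome `s` against a profile `o`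
gives `∑ |o|_r f(|s|_r + 1) ≤ ∑ (f 1 + ⋯ + f |s|_r)` when `f` is nonincreasing, and the program's
constraints at `y = |s|_r`, `z = |o|_r` turn this into `W(o) ≤ β W(s)`
(`Game.welfare_le_mul_welfare`). The constraints are linear in `(w, f)`, so linear designs inherit
the largest `β l`.

Optimality. By duality (`exists_multiplier`, `exists_lpFeasible`), if `b` is infeasible then for any
`f` some multiset of at most two kinds of pairs `(y, z)` satisfies the budget inequality of the
utilities although the welfare ratio exceeds `b`. A long staggered game realizes these pairs as
loads in a walk's outcome and in an alternative profile (`exists_game_efficiency_le`). Games with a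
single basis rule already force the bound `1 / β l` on every design. -/

theorem IsSubmodular.monotone (hs : IsSubmodular w) : Monotone w :=
  monotone_nat_of_le_succ hs.1

theorem IsSubmodular.nonneg (hs : IsSubmodular w) (h0 : w 0 = 0) (j : ℕ) : 0 ≤ w j :=
  h0 ▸ hs.monotone (Nat.zero_le j)

/-- By concavity `w` lies below the line through `(y, w y)` with slope the next marginal. That slope
is nonnegative, so `z - y` may be relaxed to `z`. -/
theorem IsSubmodular.le_add_mul (hs : IsSubmodular w) (y z : ℕ) :
    w z ≤ w y + z * (w (y + 1) - w y) := by
  rcases le_total z y with h | h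
  · have h1 := hs.monotone h
    have h2 := mul_nonneg (Nat.cast_nonneg (α := ℝ) z) (sub_nonneg.2 (hs.1 y))
    linarith
  · obtain ⟨k, rfl⟩ := Nat.exists_eq_add_of_le h
    have key : w (y + k) ≤ w y + k * (w (y + 1) - w y) := by
      clear h
      induction k with
      | zero => simp
      | succ k ih =>
        have h1 : w (y + k + 1) - w (y + k) ≤ w (y + 1) - w y := hs.2 (Nat.le_add_right y k)
        push_cast
        rw [← add_assoc]
        linarith
    have h2 := mul_nonneg (Nat.cast_nonneg (α := ℝ) y) (sub_nonneg.2 (hs.1 y))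
    push_cast
    linarith

theorem IsSubmodular.le_natCast (hs : IsSubmodular w) (h0 : w 0 = 0) (h1 : w 1 = 1) (z : ℕ) :
    w z ≤ z := by
  simpa [h0, h1] using hs.le_add_mul 0 z

/-- The least utility of one more user that satisfies the constraints of the program when `e` is
the excess of the utilities of the current users over `β` times the current welfare. -/
noncomputable def leastNext (w : WelfareRule) (e : ℝ) : ℝ :=
  ⨆ z : ℕ, (e + w (z + 1)) / (z + 1)

theorem bddAbove_leastNext (hw : ∀ z : ℕ, w z ≤ z) (e : ℝ) :
    BddAbove (Set.range fun z : ℕ => (e + w (z + 1)) / ((z : ℝ) + 1)) := by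
  refine ⟨|e| + 1, ?_⟩
  rintro _ ⟨z, rfl⟩
  have hz : (0 : ℝ) < z + 1 := by positivity
  have h1 := hw (z + 1)
  have h2 := le_abs_self e
  have h3 : 0 ≤ |e| * z := by positivity
  push_cast at h1
  simp only
  rw [div_le_iff₀ hz]
  nlinarith

theorem add_le_mul_leastNext (hw : ∀ z : ℕ, w z ≤ z) (e : ℝ) (z : ℕ) :
    e + w (z + 1) ≤ ((z + 1 : ℕ) : ℝ) * leastNext w e := by
  have h := le_ciSup (bddAbove_leastNext hw e) z
  rw [div_le_iff₀ (by positivity)] at h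
  push_cast
  rw [mul_comm]
  exact h

theorem leastNext_mono (hw : ∀ z : ℕ, w z ≤ z) : Monotone (leastNext w) := fun e e' h =>
  ciSup_mono (bddAbove_leastNext hw e') fun z => by gcongr

theorem leastNext_zero (hw : ∀ z : ℕ, w z ≤ z) (h1 : w 1 = 1) : leastNext w 0 = 1 := by
  refine le_antisymm (ciSup_le fun z => ?_) ?_
  · have := hw (z + 1)
    push_cast at this
    rw [div_le_one (by positivity)]
    linarith
  · simpa [h1] using add_le_mul_leastNext hw 0 0

/-- The terms are at least `e / (z + 1)`, which tends to `0` even for negative `e`. Hence the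
truncation `toNNReal` in `leastRule` loses nothing. -/
theorem leastNext_nonneg (hw : ∀ z : ℕ, w z ≤ z) (hn : ∀ z, 0 ≤ w z) (e : ℝ) :
    0 ≤ leastNext w e := by
  have h : Filter.Tendsto (fun z : ℕ => e / ((z : ℝ) + 1)) Filter.atTop (nhds 0) := by
    refine Filter.Tendsto.div_atTop tendsto_const_nhds ?_
    exact Filter.tendsto_atTop_add_const_right _ _ tendsto_natCast_atTop_atTop
  refine le_of_tendsto' h fun z => ?_
  refine le_trans ?_ (le_ciSup (bddAbove_leastNext hw e) z)
  have := hn (z + 1)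
  gcongr
  linarith

/-- The excess of the utilities over `β` times the welfare, for the least utility rule. -/
noncomputable def leastExcess (w : WelfareRule) (β : ℝ) : ℕ → ℝ
  | 0 => 0
  | y + 1 => leastExcess w β y + leastNext w (leastExcess w β y) - β * (w (y + 1) - w y)

/-- The least utility rule that satisfies the constraints of the program with value `β`. -/
noncomputable def leastRule (w : WelfareRule) (β : ℝ) : UtilityRule
  | 0 => 0
  | y + 1 => (leastNext w (leastExcess w β y)).toNNReal

theorem coe_leastRule_succ (hw : ∀ z : ℕ, w z ≤ z) (hn : ∀ z, 0 ≤ w z) (β : ℝ) (y : ℕ) :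
    (leastRule w β (y + 1) : ℝ) = leastNext w (leastExcess w β y) :=
  Real.coe_toNNReal _ (leastNext_nonneg hw hn _)

theorem sum_leastRule (hw : ∀ z : ℕ, w z ≤ z) (hn : ∀ z, 0 ≤ w z) (β : ℝ) (y : ℕ) :
    ∑ i ∈ Finset.Icc 1 y, (leastRule w β i : ℝ) = leastExcess w β y + β * w y := by
  have h0 : w 0 = 0 := le_antisymm (by simpa using hw 0) (hn 0)
  induction y with
  | zero => simp [leastExcess, h0]
  | succ y ih =>
    rw [Finset.sum_Icc_succ_top (by omega), ih, coe_leastRule_succ hw hn, leastExcess]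
    ring

/-- Greedy minimality: a smaller excess demands a smaller next utility, so the comparison
propagates. The program has no constraint at `y = 0`; there the normalization `f 1 = 1` agrees with
`leastNext w 0 = 1`. -/
theorem LPFeasible.leastExcess_le {f : UtilityRule} {β : ℝ} (hf : LPFeasible w f β)
    (hw : ∀ z : ℕ, w z ≤ z) (hn : ∀ z, 0 ≤ w z) (h1 : w 1 = 1) (y : ℕ) :
    leastExcess w β y ≤ (∑ i ∈ Finset.Icc 1 y, (f i : ℝ)) - β * w y := by
  have h0 : w 0 = 0 := le_antisymm (by simpa using hw 0) (hn 0)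
  induction y with
  | zero => simp [leastExcess, h0]
  | succ y ih =>
    have key : leastNext w (leastExcess w β y) ≤ f (y + 1) := by
      rcases Nat.eq_zero_or_pos y with rfl | hy
      · simp [leastExcess, leastNext_zero hw h1, hf.2.1]
      · refine ciSup_le fun z => ?_
        have := hf.2.2 y (z + 1) hy
        rw [div_le_iff₀ (by positivity)]
        push_cast at this
        linarith
    rw [Finset.sum_Icc_succ_top (by omega), leastExcess]
    linarith

theorem LPFeasible.leastExcess_nonpos {f : UtilityRule} {β : ℝ} (hf : LPFeasible w f β)
    (hw : ∀ z : ℕ, w z ≤ z) (hn : ∀ z, 0 ≤ w z) (h1 : w 1 = 1) (y : ℕ) :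
    leastExcess w β y ≤ 0 := by
  have h0 : w 0 = 0 := le_antisymm (by simpa using hw 0) (hn 0)
  rcases Nat.eq_zero_or_pos y with rfl | hy
  · simp [leastExcess]
  · have h2 := hf.leastExcess_le hw hn h1 y
    have h3 := hf.2.2 y 0 hy
    simp only [h0] at h3
    push_cast at h3
    linarith

/-- After a rise by `δ > 0`, the next utility is no smaller and the next marginal welfare no larger,
so each later step rises by at least `δ` too. The excess would become positive, which feasibility of
`β` forbids. -/
theorem LPFeasible.leastExcess_antitone {f : UtilityRule} {β : ℝ} (hf : LPFeasible w f β)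
    (hs : IsSubmodular w) (h0 : w 0 = 0) (h1 : w 1 = 1) : Antitone (leastExcess w β) := by
  have hw := hs.le_natCast h0 h1
  have hn := hs.nonneg h0
  refine antitone_nat_of_succ_le fun y => ?_
  by_contra! hlt
  set δ := leastExcess w β (y + 1) - leastExcess w β y with hδ
  have hδ0 : 0 < δ := sub_pos.2 hlt
  have hstep : ∀ k, δ ≤ leastExcess w β (y + k + 1) - leastExcess w β (y + k) ∧
      leastExcess w β y + k * δ ≤ leastExcess w β (y + k) := by
    intro k
    induction k with
    | zero => simp [hδ]
    | succ k ih =>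
      obtain ⟨ih1, ih2⟩ := ih
      have hm := leastNext_mono hw (show leastExcess w β (y + k) ≤ leastExcess w β (y + k + 1) by
        linarith)
      have hd : w (y + k + 1 + 1) - w (y + k + 1) ≤ w (y + k + 1) - w (y + k) :=
        hs.2 (Nat.le_succ (y + k))
      have hd' := mul_le_mul_of_nonneg_left hd hf.1
      have e1 : leastExcess w β (y + k + 1 + 1) = leastExcess w β (y + k + 1) +
        leastNext w (leastExcess w β (y + k + 1)) - β * (w (y + k + 1 + 1) - w (y + k + 1)) := rfl
      have e2 : leastExcess w β (y + k + 1) = leastExcess w β (y + k) +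
        leastNext w (leastExcess w β (y + k)) - β * (w (y + k + 1) - w (y + k)) := rfl
      rw [← add_assoc]
      push_cast
      constructor <;> linarith
  obtain ⟨k, hk⟩ := exists_nat_gt (-leastExcess w β y / δ)
  rw [div_lt_iff₀ hδ0] at hk
  have := (hstep k).2
  have := hf.leastExcess_nonpos hw hn h1 (y + k)
  linarith

/-- Every feasible value of the program is attained by a nonincreasing rule. -/
theorem LPFeasible.exists_antitoneOn {f : UtilityRule} {β : ℝ} (hf : LPFeasible w f β)
    (hs : IsSubmodular w) (h0 : w 0 = 0) (h1 : w 1 = 1) :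
    ∃ g : UtilityRule, LPFeasible w g β ∧ AntitoneOn g (Set.Ici 1) ∧ g ≤ 1 := by
  have hw := hs.le_natCast h0 h1
  have hn := hs.nonneg h0
  have hg1 : leastRule w β 1 = 1 := by
    simp [leastRule, leastExcess, leastNext_zero hw h1]
  have hanti : AntitoneOn (leastRule w β) (Set.Ici 1) := by
    intro i hi j hj hij
    obtain ⟨i, rfl⟩ := Nat.exists_eq_add_of_le' (Set.mem_Ici.1 hi)
    obtain ⟨j, rfl⟩ := Nat.exists_eq_add_of_le' (Set.mem_Ici.1 hj)
    rw [← NNReal.coe_le_coe, coe_leastRule_succ hw hn, coe_leastRule_succ hw hn]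
    exact leastNext_mono hw (hf.leastExcess_antitone hs h0 h1 (by omega))
  refine ⟨leastRule w β, ⟨hf.1, hg1, fun y z hy => ?_⟩, hanti, fun i => ?_⟩
  · rw [sum_leastRule hw hn, coe_leastRule_succ hw hn]
    rcases z with _ | z
    · simpa [h0] using hf.leastExcess_nonpos hw hn h1 y
    · have := add_le_mul_leastNext hw (leastExcess w β y) z
      linarith
  · rcases Nat.eq_zero_or_pos i with rfl | hi
    · simp [leastRule]
    · exact (hanti (Set.mem_Ici.2 le_rfl) (Set.mem_Ici.2 hi) hi).trans_eq hg1

/-- The marginal contributions are feasible with value `2`. -/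
theorem lpFeasible_marginal (hs : IsSubmodular w) (h0 : w 0 = 0) (h1 : w 1 = 1) :
    LPFeasible w (fun i => (w i - w (i - 1)).toNNReal) 2 := by
  have hc : ∀ i, (((w (i + 1) - w i).toNNReal : ℝ≥0) : ℝ) = w (i + 1) - w i := fun i =>
    Real.coe_toNNReal _ (sub_nonneg.2 (hs.1 i))
  have hsum : ∀ y, ∑ i ∈ Finset.Icc 1 y, ((w i - w (i - 1)).toNNReal : ℝ) = w y := by
    intro y
    induction y with
    | zero => simp [h0]
    | succ y ih =>
      rw [Finset.sum_Icc_succ_top (by omega), ih, Nat.add_sub_cancel, hc]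
      ring
  refine ⟨by norm_num, by simp [h0, h1], fun y z _ => ?_⟩
  beta_reduce
  rw [hsum, Nat.add_sub_cancel, hc]
  linarith [hs.le_add_mul y z]

theorem LPFeasible.one_le {f : UtilityRule} {β : ℝ} (hf : LPFeasible w f β)
    (h0 : w 0 = 0) (h1 : w 1 = 1) : 1 ≤ β := by
  simpa [h0, h1, hf.2.1] using hf.2.2 1 0 le_rfl

theorem isClosed_setOf_lpFeasible (w : WelfareRule) :
    IsClosed {p : ℝ × UtilityRule | LPFeasible w p.2 p.1} := by
  have hev : ∀ i : ℕ, Continuous fun p : ℝ × UtilityRule => (p.2 i : ℝ) := fun i =>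
    NNReal.continuous_coe.comp ((continuous_apply i).comp continuous_snd)
  simp only [LPFeasible, Set.ofPred_and, Set.ofPred_forall]
  refine (isClosed_le continuous_const continuous_fst).inter (IsClosed.inter ?_ ?_)
  · exact isClosed_eq ((continuous_apply 1).comp continuous_snd) continuous_const
  · refine isClosed_iInter fun y => isClosed_iInter fun z => isClosed_iInter fun _ =>
      isClosed_le ?_ (continuous_fst.mul continuous_const)
    exact ((continuous_finsetSum _ fun i _ => hev i).sub
      (continuous_const.mul (hev _))).add continuous_const

/-- The linear program has a nonincreasing optimal solution. -/
theorem exists_isLPSolution (hs : IsSubmodular w) (h0 : w 0 = 0) (h1 : w 1 = 1) :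
    ∃ β : ℝ, ∃ u : UtilityRule, IsLPSolution w u β ∧ AntitoneOn u (Set.Ici 1) := by
  -- The box loses nothing: the marginal rule shows that `2` is feasible, and every feasible value
  -- is attained by a rule bounded by `1`.
  let K : Set (ℝ × UtilityRule) :=
    (Set.Icc 0 2 ×ˢ Set.Icc 0 1) ∩ {p | LPFeasible w p.2 p.1}
  have hK : IsCompact K := (isCompact_Icc.prod isCompact_Icc).inter_right
    (isClosed_setOf_lpFeasible w)
  have hmem : ∀ f β, LPFeasible w f β → β ≤ 2 → ∃ g, (β, g) ∈ K := by
    intro f β hf h2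
    obtain ⟨g, hg, -, hg1⟩ := hf.exists_antitoneOn hs h0 h1
    exact ⟨g, ⟨⟨⟨hf.1, h2⟩, ⟨fun _ => bot_le, hg1⟩⟩, hg⟩⟩
  have hne : K.Nonempty :=
    let ⟨g, hg⟩ := hmem _ _ (lpFeasible_marginal hs h0 h1) le_rfl
    ⟨_, hg⟩
  obtain ⟨⟨β, f⟩, hp, hmin⟩ := hK.exists_isMinOn hne continuous_fst.continuousOn
  obtain ⟨u, hu, hanti, -⟩ := LPFeasible.exists_antitoneOn hp.2 hs h0 h1
  refine ⟨β, u, ⟨hu, fun f' β' hf' => ?_⟩, hanti⟩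
  rcases le_total β' 2 with h | h
  · obtain ⟨g, hg⟩ := hmem f' β' hf' h
    exact hmin hg
  · exact hp.1.1.2.trans h

/-! ### Duality for a fixed utility rule -/

/-- A system of inequalities `c * D p ≤ E p` in one nonnegative unknown `c` is solvable if no
integral combination of two of them is contradictory. -/
theorem exists_multiplier {ι : Type*} (D E : ι → ℝ)
    (H : ∀ p q : ι, ∀ a b : ℕ, 0 ≤ a * D p + b * D q → 0 ≤ a * E p + b * E q)
    {p₀ : ι} (hp₀ : 0 < D p₀) : ∃ c : ℝ, 0 ≤ c ∧ ∀ p, c * D p ≤ E p := by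
  have hE : ∀ p, 0 ≤ D p → 0 ≤ E p := fun p hp => by simpa using H p p 1 0 (by simpa using hp)
  have hcross : ∀ p q, D p < 0 → 0 < D q → E p / D p ≤ E q / D q := by
    intro p q hp hq
    -- The weights `1` and `-D p / D q` would cancel `D` exactly but need not be integers. Scaling
    -- by `k` and rounding up costs at most one `E q`, negligible as `k` grows.
    have hlim : ∀ k : ℕ, k * (-(E p + (-D p / D q) * E q)) ≤ E q := by
      intro k
      have hc := Nat.le_ceil (k * (-D p / D q))
      have hc' := (Nat.ceil_lt_add_one (show 0 ≤ k * (-D p / D q) from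
        mul_nonneg k.cast_nonneg (div_nonneg (by linarith) hq.le))).le
      have h1 := H p q k ⌈k * (-D p / D q)⌉₊ (by
        have h2 := mul_le_mul_of_nonneg_right hc hq.le
        have h3 : k * (-D p / D q) * D q = -(k * D p) := by field_simp
        linarith)
      have h2 := mul_le_mul_of_nonneg_right hc' (hE q hq.le)
      linarith
    have hnn : 0 ≤ E p + (-D p / D q) * E q := by
      by_contra! hneg
      obtain ⟨k, hk⟩ := exists_nat_gt (E q / (-(E p + (-D p / D q) * E q)))
      rw [div_lt_iff₀ (by linarith)] at hk
      exact absurd (hlim k) (not_le.2 hk)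
    rw [div_le_iff_of_neg hp]
    have h4 : -D p / D q * E q = -(E q / D q * D p) := by ring
    linarith
  -- These are all the lower bounds on `c`; the indices with `D p > 0` give the upper bounds, and
  -- `p₀` ensures that there is one.
  let S : Set ℝ := insert 0 ((fun p => E p / D p) '' {p | D p < 0})
  have hS : ∀ q, 0 < D q → ∀ x ∈ S, x ≤ E q / D q := by
    rintro q hq x (rfl | ⟨p, hp, rfl⟩)
    · exact div_nonneg (hE q hq.le) hq.le
    · exact hcross p q hp hq
  have hbdd : BddAbove S := ⟨_, hS p₀ hp₀⟩
  refine ⟨sSup S, le_csSup hbdd (Set.mem_insert _ _), fun p => ?_⟩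
  rcases lt_trichotomy (D p) 0 with hp | hp | hp
  · rw [← div_le_iff_of_neg hp]
    exact le_csSup hbdd (Set.mem_insert_of_mem _ ⟨p, hp, rfl⟩)
  · simpa [hp] using hE p hp.ge
  · rw [← le_div_iff₀ hp]
    exact csSup_le (Set.insert_nonempty _ _) (hS p hp)

/-- If no two types of resources, repeated `a` and `b` times, witness an inefficiency of the rule
`f` beyond `β`, then `β` is feasible for the linear program. -/
theorem exists_lpFeasible (h0 : w 0 = 0) (h1 : w 1 = 1) (f : UtilityRule) {β : ℝ} (hβ : 0 ≤ β)
    (H : ∀ p q : ℕ × ℕ, ∀ a b : ℕ,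
      a * (p.2 * (f (p.1 + 1) : ℝ)) + b * (q.2 * (f (q.1 + 1) : ℝ)) ≤
        a * (∑ i ∈ Finset.Icc 1 p.1, (f i : ℝ)) + b * (∑ i ∈ Finset.Icc 1 q.1, (f i : ℝ)) →
      a * w p.2 + b * w q.2 ≤ β * (a * w p.1 + b * w q.1)) :
    ∃ F : UtilityRule, LPFeasible w F β := by
  have hf1 : 0 < (f 1 : ℝ) := by
    refine lt_of_le_of_ne (f 1).2 fun h => ?_
    have := H (0, 1) (0, 1) 1 0 (by simp [← h])
    norm_num [h0, h1] at this
  obtain ⟨c, hc, hcD⟩ := exists_multiplier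
    (fun p : ℕ × ℕ => (∑ i ∈ Finset.Icc 1 p.1, (f i : ℝ)) - p.2 * (f (p.1 + 1) : ℝ))
    (fun p => β * w p.1 - w p.2) (fun p q a b hab => by
      have := H p q a b (by linarith)
      linarith) (p₀ := (1, 0)) (by simpa using hf1)
  have hc1 : 1 ≤ c * f 1 := by
    have := hcD (0, 1)
    simp [h0, h1] at this
    linarith
  lift c to ℝ≥0 using hc
  -- Lowering the value at `1` from `c * f 1` to `1` only decreases the sums, and `f (y + 1)` with
  -- `y ≥ 1` never refers to it.
  refine ⟨fun i => if i = 1 then 1 else c * f i, hβ, by simp, fun y z hy => ?_⟩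
  have hsum : ∑ i ∈ Finset.Icc 1 y, (((if i = 1 then 1 else c * f i : ℝ≥0)) : ℝ) ≤
      c * ∑ i ∈ Finset.Icc 1 y, (f i : ℝ) := by
    rw [Finset.mul_sum]
    refine Finset.sum_le_sum fun i _ => ?_
    split_ifs with hi
    · simpa [hi] using hc1
    · simp
  have := hcD (y, z)
  beta_reduce
  rw [if_neg (by omega)]
  push_cast
  simp only at this
  linarith

end LinearProgram

end ResourceGame

namespace ResourceGame

/-! ### One-round walks, welfare and the smoothness bound -/

namespace Game

variable (G : Game)

/-- The profile in which the agents before `τ` play as in `s` and the others have not moved. -/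
def truncate (s : G.Profile) (τ : ℕ) : G.Profile := fun i => if (i : ℕ) < τ then s i else ∅

/-- The number of agents before `i` that use the resource `r`. -/
def loadBefore (s : G.Profile) (i : Fin G.n) (r : Fin G.c) : ℕ :=
  (Finset.univ.filter fun j => j < i ∧ r ∈ s j).card

variable {G}

theorem truncate_n (s : G.Profile) : G.truncate s G.n = s := by
  ext i : 1
  simp [truncate]

theorem update_truncate (s : G.Profile) (i : Fin G.n) :
    Function.update (G.truncate s i) i (s i) = G.truncate s (i + 1) := by
  ext j : 1
  rcases eq_or_ne j i with rfl | h
  · simp [truncate]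
  · have : (j : ℕ) ≠ i := fun h' => h (Fin.ext h')
    have h2 : (j : ℕ) < i + 1 ↔ (j : ℕ) < i := by omega
    simp [truncate, h, h2]

theorem load_update_truncate (s : G.Profile) (i : Fin G.n) (x : Finset (Fin G.c)) {r : Fin G.c}
    (hr : r ∈ x) :
    G.load (Function.update (G.truncate s i) i x) r = G.loadBefore s i r + 1 := by
  rw [load, loadBefore, ← Finset.card_insert_of_notMem (a := i) (by simp)]
  congr 1
  ext j
  rcases eq_or_ne j i with rfl | h
  · simp [hr]
  · by_cases hji : j < i
    · simp [truncate, h, hji]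
    · simp [truncate, h, hji]

theorem utility_update_truncate (s : G.Profile) (i : Fin G.n) (x : Finset (Fin G.c)) :
    G.utility i (Function.update (G.truncate s i) i x) =
      ∑ r ∈ x, (G.f r (G.loadBefore s i r + 1) : ℝ) := by
  rw [utility, Function.update_self]
  exact Finset.sum_congr rfl fun r hr => by rw [load_update_truncate s i x hr]

/-- The outcomes of a one-round walk are the profiles in which every agent plays a best response to
the actions of its predecessors. -/
theorem mem_sol_one {s : G.Profile} :
    s ∈ G.sol 1 ↔ ∀ i, s i ∈ G.bestResponses i (G.truncate s i) := by
  constructor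
  · rintro ⟨a, ⟨h0, ha⟩, rfl⟩
    rw [one_mul] at ha ⊢
    have hstep : ∀ i : Fin G.n, ∃ b ∈ G.bestResponses i (a i),
        a (i + 1) = Function.update (a i) i b := fun i =>
      ha i i.2 i (Nat.mod_eq_of_lt i.2).symm
    have hlate : ∀ τ ≤ G.n, ∀ i : Fin G.n, τ ≤ i → a τ i = ∅ := by
      intro τ hτ
      induction τ with
      | zero => simp [h0]
      | succ τ ih =>
        intro i hi
        obtain ⟨b, -, hb⟩ := hstep ⟨τ, hτ⟩
        simp only at hb
        rw [hb, Function.update_of_ne (by rintro rfl; simp at hi)]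
        exact ih (by omega) i (by omega)
    have hearly : ∀ τ ≤ G.n, ∀ i : Fin G.n, (i : ℕ) < τ → a τ i = a (i + 1) i := by
      intro τ hτ
      induction τ with
      | zero => simp
      | succ τ ih =>
        intro i hi
        rcases Nat.lt_succ_iff_lt_or_eq.1 hi with h | h
        · obtain ⟨b, -, hb⟩ := hstep ⟨τ, hτ⟩
          simp only at hb
          rw [hb, Function.update_of_ne (by rintro rfl; simp at h)]
          exact ih (by omega) i h
        · rw [h]
    have htr : ∀ i : Fin G.n, G.truncate (a G.n) i = a i := by
      intro i
      ext j : 1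
      unfold truncate
      split_ifs with h
      · rw [hearly _ le_rfl j j.2, hearly _ i.2.le j h]
      · exact (hlate _ i.2.le j (not_lt.1 h)).symm
    intro i
    obtain ⟨b, hb, hab⟩ := hstep i
    rw [htr, hearly _ le_rfl i i.2, hab, Function.update_self]
    exact hb
  · intro h
    refine ⟨G.truncate s, ⟨by ext; simp [truncate], fun τ hτ i hi => ?_⟩, ?_⟩
    · rw [one_mul] at hτ
      rw [Nat.mod_eq_of_lt hτ] at hi
      subst hi
      exact ⟨s i, h i, (update_truncate s i).symm⟩
    · rw [one_mul, truncate_n]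

theorem bestResponses_nonempty (i : Fin G.n) (a : G.Profile) : (G.bestResponses i a).Nonempty := by
  obtain ⟨b, hb, hmax⟩ := (G.actions i).exists_max_image
    (fun b => G.utility i (Function.update a i b)) (G.actions_nonempty i)
  exact ⟨b, hb, hmax⟩

theorem sol_one_nonempty : (G.sol 1).Nonempty := by
  choose br hbr using fun (i : Fin G.n) a => bestResponses_nonempty i a
  let a : ℕ → G.Profile := fun τ => Nat.rec (fun _ => ∅)
    (fun τ p => if h : τ < G.n then Function.update p ⟨τ, h⟩ (br ⟨τ, h⟩ p) else p) τ
  refine ⟨_, a, ⟨rfl, fun τ hτ i hi => ?_⟩, rfl⟩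
  rw [one_mul] at hτ
  rw [Nat.mod_eq_of_lt hτ] at hi
  subst hi
  exact ⟨br i (a i), hbr _ _, by simp [a]⟩

theorem welfare_eq_sum (h0 : ∀ r, G.w r 0 = 0) (a : G.Profile) :
    G.welfare a = ∑ r, G.w r (G.load a r) := by
  refine Finset.sum_subset (Finset.subset_univ _) fun r _ hr => ?_
  have : G.load a r = 0 := by
    simpa [load, Finset.filter_eq_empty_iff] using hr
  rw [this, h0]

theorem welfare_nonneg (hn : ∀ r j, 0 ≤ G.w r j) (a : G.Profile) : 0 ≤ G.welfare a :=
  Finset.sum_nonneg fun r _ => hn r _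

theorem efficiency_nonneg (hn : ∀ r j, 0 ≤ G.w r j) (k : ℕ) : 0 ≤ G.efficiency k := by
  refine div_nonneg (Real.sInf_nonneg ?_) (Real.sSup_nonneg ?_) <;>
  · rintro _ ⟨a, -, rfl⟩
    exact welfare_nonneg hn a

theorem sum_card_lt {n : ℕ} (S : Finset (Fin n)) (g : ℕ → ℝ) :
    ∑ i ∈ S, g ((S.filter fun j => j < i).card + 1) = ∑ k ∈ Finset.Icc 1 S.card, g k := by
  induction S using Finset.induction_on_max with
  | empty => simp
  | insert a S ha ih =>
    have hna : a ∉ S := fun h => lt_irrefl _ (ha a h)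
    rw [Finset.sum_insert hna, Finset.card_insert_of_notMem hna,
      Finset.sum_Icc_succ_top (by omega), ← ih, add_comm]
    congr 1
    · refine Finset.sum_congr rfl fun i hi => ?_
      rw [Finset.filter_insert, if_neg (ha i hi).not_gt]
    · rw [Finset.filter_insert, if_neg (lt_irrefl _), Finset.filter_true_of_mem ha]

/-- In the course of a one-round walk every resource hands out `f 1`, `f 2`, and so on. -/
theorem sum_loadBefore (s : G.Profile) :
    ∑ i, ∑ r ∈ s i, (G.f r (G.loadBefore s i r + 1) : ℝ) =
      ∑ r, ∑ k ∈ Finset.Icc 1 (G.load s r), (G.f r k : ℝ) := by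
  rw [Finset.sum_comm' (t' := Finset.univ) (s' := fun r => Finset.univ.filter fun i => r ∈ s i)
    (by simp)]
  refine Finset.sum_congr rfl fun r _ => ?_
  rw [load, ← sum_card_lt _ fun k => (G.f r k : ℝ)]
  refine Finset.sum_congr rfl fun i _ => ?_
  rw [loadBefore, Finset.filter_filter]
  simp only [and_comm]

/-- The smoothness argument: the best-response inequalities of a one-round walk, summed. -/
theorem welfare_le_mul_welfare {β : ℝ} (h0 : ∀ r, G.w r 0 = 0)
    (hanti : ∀ r, AntitoneOn (G.f r) (Set.Ici 1))
    (hβ : ∀ r y z, (∑ i ∈ Finset.Icc 1 y, (G.f r i : ℝ)) - z * (G.f r (y + 1) : ℝ) + G.w r z ≤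
      β * G.w r y)
    {s o : G.Profile} (hs : s ∈ G.sol 1) (ho : o ∈ G.jointActions) :
    G.welfare o ≤ β * G.welfare s := by
  rw [mem_sol_one] at hs
  have h1 : ∑ i, ∑ r ∈ o i, (G.f r (G.loadBefore s i r + 1) : ℝ) ≤
      ∑ r, ∑ k ∈ Finset.Icc 1 (G.load s r), (G.f r k : ℝ) := by
    rw [← sum_loadBefore]
    refine Finset.sum_le_sum fun i _ => ?_
    have := (hs i).2 (o i) (ho i)
    rwa [utility_update_truncate, utility_update_truncate] at this
  -- The predecessors of an agent that use `r` are among all its users in `s`, and `f` is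
  -- nonincreasing.
  have h2 : ∑ r, G.load o r * (G.f r (G.load s r + 1) : ℝ) ≤
      ∑ i, ∑ r ∈ o i, (G.f r (G.loadBefore s i r + 1) : ℝ) := by
    rw [Finset.sum_comm' (t' := Finset.univ) (s' := fun r => Finset.univ.filter fun i => r ∈ o i)
      (by simp)]
    refine Finset.sum_le_sum fun r _ => ?_
    rw [load, ← nsmul_eq_mul, ← Finset.sum_const]
    refine Finset.sum_le_sum fun i _ => ?_
    refine NNReal.coe_le_coe.2 (hanti r (Set.mem_Ici.2 (by omega)) (Set.mem_Ici.2 (by omega)) ?_)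
    refine Nat.succ_le_succ (Finset.card_le_card fun j hj => ?_)
    simp only [Finset.mem_filter] at hj ⊢
    exact ⟨hj.1, hj.2.2⟩
  have h3 := Finset.sum_le_sum fun r (_ : r ∈ Finset.univ) => hβ r (G.load s r) (G.load o r)
  rw [Finset.sum_add_distrib, Finset.sum_sub_distrib, ← Finset.mul_sum] at h3
  rw [welfare_eq_sum h0, welfare_eq_sum h0]
  linarith

theorem one_div_le_efficiency {β : ℝ} (hβ0 : 0 < β)
    (h : ∀ s ∈ G.sol 1, ∀ o ∈ G.jointActions, G.welfare o ≤ β * G.welfare s)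
    (hpos : ∃ a ∈ G.jointActions, 0 < G.welfare a) : 1 / β ≤ G.efficiency 1 := by
  obtain ⟨a, ha, ha0⟩ := hpos
  have hsup : 0 < sSup (G.welfare '' G.jointActions) :=
    ha0.trans_le (le_csSup (Set.toFinite _).bddAbove (Set.mem_image_of_mem _ ha))
  rw [efficiency, div_le_div_iff₀ hβ0 hsup, one_mul]
  refine csSup_le ⟨_, Set.mem_image_of_mem _ ha⟩ ?_
  rintro _ ⟨o, ho, rfl⟩
  rw [← div_le_iff₀ hβ0]
  refine le_csInf (sol_one_nonempty.image _) ?_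
  rintro _ ⟨s, hs, rfl⟩
  rw [div_le_iff₀ hβ0, mul_comm]
  exact h s hs o ho

theorem efficiency_le_one_div {β : ℝ} (hβ0 : 0 < β) {s o : G.Profile} (hs : s ∈ G.sol 1)
    (ho : o ∈ G.jointActions) (hpos : 0 < G.welfare o) (h : β * G.welfare s ≤ G.welfare o) :
    G.efficiency 1 ≤ 1 / β := by
  have hle : G.welfare o ≤ sSup (G.welfare '' G.jointActions) :=
    le_csSup (Set.toFinite _).bddAbove (Set.mem_image_of_mem _ ho)
  have hinf : sInf (G.welfare '' G.sol 1) ≤ G.welfare s :=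
    csInf_le (Set.toFinite _).bddBelow (Set.mem_image_of_mem _ hs)
  rw [efficiency, div_le_div_iff₀ (hpos.trans_le hle) hβ0, one_mul]
  have := mul_le_mul_of_nonneg_left hinf hβ0.le
  linarith

end Game

end ResourceGame

namespace ResourceGame

/-! ### Inefficient games -/

section ShiftGame

variable {ι : Type} [Fintype ι] (w : WelfareRule) (f : UtilityRule) (y z : ι → ℕ) (K R : ℕ)

/-- The resources, in `R` rows that are indexed by the types `ι`. -/
noncomputable def shiftEquiv (ι : Type) [Fintype ι] (R : ℕ) :
    Fin (Fintype.card (Fin R × ι)) ≃ Fin R × ι := (Fintype.equivFin _).symm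

/-- Agent `i` uses those of type `t` in row `r` for which `r + d ≤ i < r + d + x t`. -/
noncomputable def shiftSet (x : ι → ℕ) (d R i : ℕ) : Finset (Fin (Fintype.card (Fin R × ι))) :=
  Finset.univ.filter fun r =>
    ((shiftEquiv ι R r).1 : ℕ) + d ≤ i ∧ i < (shiftEquiv ι R r).1 + d + x (shiftEquiv ι R r).2

theorem mem_shiftSet {x : ι → ℕ} {d R i : ℕ} {r : Fin (Fintype.card (Fin R × ι))} :
    r ∈ shiftSet x d R i ↔ ((shiftEquiv ι R r).1 : ℕ) + d ≤ i ∧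
      i < (shiftEquiv ι R r).1 + d + x (shiftEquiv ι R r).2 := by
  simp [shiftSet]

theorem sum_shiftEquiv (g : ℕ → ι → ℝ) :
    ∑ r, g (shiftEquiv ι R r).1 (shiftEquiv ι R r).2 = ∑ t, ∑ r ∈ Finset.range R, g r t := by
  rw [Equiv.sum_comp (shiftEquiv ι R) (fun p => g p.1 p.2), Fintype.sum_prod_type,
    Finset.sum_comm]
  exact Finset.sum_congr rfl fun t _ => Fin.sum_univ_eq_sum_range (fun r => g r t) R

theorem sum_shiftSet (x : ι → ℕ) (d i : ℕ) (g : ℕ → ι → ℝ) :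
    ∑ r ∈ shiftSet x d R i, g (shiftEquiv ι R r).1 (shiftEquiv ι R r).2 =
      ∑ t, ∑ r ∈ (Finset.range R).filter (fun r => r + d ≤ i ∧ i < r + d + x t), g r t := by
  rw [shiftSet, Finset.sum_filter]
  rw [sum_shiftEquiv R fun r t => if r + d ≤ i ∧ i < r + d + x t then g r t else 0]
  simp only [Finset.sum_filter]

/-- The game in which agent `i` uses the resources of type `t` in the rows `i - y t + 1, …, i` or
those of type `t` in the rows `i - K - z t + 1, …, i - K`. The agents close to the ends have only
the first option. -/
noncomputable abbrev shiftGame : Game where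
  n := R + K
  c := Fintype.card (Fin R × ι)
  actions i := {shiftSet y 0 R i, if K ≤ i ∧ (i : ℕ) < R then shiftSet z K R i
    else shiftSet y 0 R i}
  actions_nonempty _ := Finset.insert_nonempty _ _
  w _ := w
  f _ := f

/-- In this profile the resources of type `t` are used `y t` times. -/
noncomputable def shiftOutcome : (shiftGame w f y z K R).Profile :=
  fun i => shiftSet y 0 R i

/-- In this profile most of the resources of type `t` are used at least `z t` times. -/
noncomputable def shiftTarget : (shiftGame w f y z K R).Profile :=
  fun i => if K ≤ i ∧ (i : ℕ) < R then shiftSet z K R i else shiftSet y 0 R i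

theorem card_filter_fin {n a b : ℕ} (h : b ≤ n) :
    (Finset.univ.filter fun j : Fin n => a ≤ j ∧ (j : ℕ) < b).card = b - a := by
  rw [← Nat.card_Ico, ← Finset.card_map Fin.valEmbedding]
  congr 1
  ext k
  simp only [Finset.mem_map, Finset.mem_filter, Finset.mem_univ, true_and, Fin.valEmbedding_apply,
    Finset.mem_Ico]
  constructor
  · rintro ⟨j, hj, rfl⟩
    exact hj
  · exact fun hk => ⟨⟨k, by omega⟩, hk, rfl⟩

variable {y z K}

theorem load_shiftOutcome (hy : ∀ t, y t ≤ K) (r : Fin (Fintype.card (Fin R × ι))) :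
    (shiftGame w f y z K R).load (shiftOutcome w f y z K R) r = y (shiftEquiv ι R r).2 := by
  have h := (shiftEquiv ι R r).1.2
  have h' := hy (shiftEquiv ι R r).2
  have := card_filter_fin (n := R + K) (a := (shiftEquiv ι R r).1)
    (b := (shiftEquiv ι R r).1 + y (shiftEquiv ι R r).2) (by omega)
  simp only [Nat.add_sub_cancel_left] at this
  simp only [Game.load, shiftOutcome, mem_shiftSet]
  exact this

theorem loadBefore_shiftOutcome (hy : ∀ t, y t ≤ K) (i : Fin (R + K))
    (r : Fin (Fintype.card (Fin R × ι))) :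
    (shiftGame w f y z K R).loadBefore (shiftOutcome w f y z K R) i r =
      min ((i : ℕ) - (shiftEquiv ι R r).1) (y (shiftEquiv ι R r).2) := by
  have h := (shiftEquiv ι R r).1.2
  have h' := hy (shiftEquiv ι R r).2
  have := card_filter_fin (n := R + K) (a := (shiftEquiv ι R r).1)
    (b := min i ((shiftEquiv ι R r).1 + y (shiftEquiv ι R r).2)) (by omega)
  rw [show min (i : ℕ) ((shiftEquiv ι R r).1 + y (shiftEquiv ι R r).2) - (shiftEquiv ι R r).1 =
    min ((i : ℕ) - (shiftEquiv ι R r).1) (y (shiftEquiv ι R r).2) by omega] at this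
  simp only [Game.loadBefore, shiftOutcome, mem_shiftSet]
  rw [← this]
  refine congrArg _ (Finset.filter_congr fun j _ => ?_)
  rw [Fin.lt_def]
  omega

theorem shiftOutcome_mem_sol (hy : ∀ t, y t ≤ K)
    (hf : ∑ t, z t * (f (y t + 1) : ℝ) ≤ ∑ t, ∑ k ∈ Finset.Icc 1 (y t), (f k : ℝ)) :
    shiftOutcome w f y z K R ∈ (shiftGame w f y z K R).sol 1 := by
  rw [Game.mem_sol_one]
  intro i
  refine ⟨Finset.mem_insert_self _ _, fun b hb => ?_⟩
  rcases Finset.mem_insert.1 hb with rfl | hb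
  · exact le_rfl
  rw [Finset.mem_singleton] at hb
  subst hb
  split_ifs with hi
  swap
  · exact le_rfl
  rw [Game.utility_update_truncate, Game.utility_update_truncate]
  simp only [loadBefore_shiftOutcome w f R hy]
  refine ((sum_shiftSet R z K i fun r t => (f (min (i - r) (y t) + 1) : ℝ)).trans_le ?_).trans
    (hf.trans ?_)
  · refine Finset.sum_le_sum fun t _ => ?_
    -- The alternative lies in rows at most `i - K`, whose resources have already received all their
    -- `y t ≤ K` users.
    have hconst : ∀ r ∈ (Finset.range R).filter
        (fun r => r + K ≤ i ∧ (i : ℕ) < r + K + z t),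
        (f (min (i - r) (y t) + 1) : ℝ) = f (y t + 1) := by
      intro r hr
      have h' := hy t
      simp only [Finset.mem_filter] at hr
      rw [min_eq_right (by omega)]
    rw [Finset.sum_congr rfl hconst, Finset.sum_const, nsmul_eq_mul]
    refine mul_le_mul_of_nonneg_right (Nat.cast_le.2 ?_) (NNReal.coe_nonneg _)
    have hsub : (Finset.range R).filter (fun r => r + K ≤ i ∧ (i : ℕ) < r + K + z t) ⊆
        Finset.Ico (i - K + 1 - z t) (i - K + 1) := by
      intro r hr
      simp only [Finset.mem_filter] at hr
      rw [Finset.mem_Ico]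
      omega
    refine (Finset.card_le_card hsub).trans ?_
    rw [Nat.card_Ico]
    omega
  -- Since `K ≤ i < R`, no row is cut off at an end; agent `i` is user number `i + 1 - r` in row
  -- `r`, so it collects each of `f 1, …, f (y t)` once.
  · refine ((sum_shiftSet R y 0 i fun r t => (f (min (i - r) (y t) + 1) : ℝ)).trans
      (Finset.sum_congr rfl fun t _ => ?_)).ge
    have h' := hy t
    refine Finset.sum_bij' (fun r _ => (i : ℕ) + 1 - r) (fun k _ => (i : ℕ) + 1 - k) ?_ ?_ ?_ ?_ ?_
    all_goals
      intro k hk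
      simp only [Finset.mem_filter, Finset.mem_Icc, Finset.mem_range] at hk ⊢
    any_goals omega
    rw [show min ((i : ℕ) - k) (y t) + 1 = i + 1 - k by omega]

theorem welfare_shiftOutcome (h0 : w 0 = 0) (hy : ∀ t, y t ≤ K) :
    (shiftGame w f y z K R).welfare (shiftOutcome w f y z K R) = R * ∑ t, w (y t) := by
  rw [Game.welfare_eq_sum fun _ => h0]
  simp only [load_shiftOutcome w f R hy]
  refine (sum_shiftEquiv R fun _ t => w (y t)).trans ?_
  simp [Finset.mul_sum]

theorem shiftTarget_mem : shiftTarget w f y z K R ∈ (shiftGame w f y z K R).jointActions :=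
  fun _ => Finset.mem_insert_of_mem (Finset.mem_singleton_self _)

theorem le_welfare_shiftTarget (h0 : w 0 = 0) (hw : Monotone w) {L : ℕ}
    (hz : ∀ t, z t ≤ L) (Q : ℕ) (hR : R = Q + K + L) :
    Q * ∑ t, w (z t) ≤
      (shiftGame w f y z K R).welfare (shiftTarget w f y z K R) := by
  have hn : ∀ j, 0 ≤ w j := fun j => h0 ▸ hw (Nat.zero_le j)
  rw [Game.welfare_eq_sum fun _ => h0]
  have h1 : (Q : ℝ) * ∑ t, w (z t) =
      ∑ t, ∑ r ∈ Finset.range R, if r < Q then w (z t) else 0 := by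
    rw [Finset.mul_sum]
    refine Finset.sum_congr rfl fun t _ => ?_
    rw [← Finset.sum_filter, Finset.sum_const, nsmul_eq_mul,
      show (Finset.range R).filter (fun r => r < Q) = Finset.range Q by
        ext r
        simp only [Finset.mem_filter, Finset.mem_range]
        omega, Finset.card_range]
  rw [h1, ← sum_shiftEquiv R fun r t => if r < Q then w (z t) else 0]
  refine Finset.sum_le_sum fun r _ => ?_
  split_ifs with hr
  swap
  · exact hn _
  refine hw ?_
  have h' := hz (shiftEquiv ι R r).2
  have hc := card_filter_fin (n := R + K) (a := (shiftEquiv ι R r).1 + K)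
    (b := (shiftEquiv ι R r).1 + K + z (shiftEquiv ι R r).2) (by omega)
  rw [Nat.add_sub_cancel_left] at hc
  rw [← hc]
  refine Finset.card_le_card fun j hj => ?_
  simp only [Finset.mem_filter, Finset.mem_univ, true_and] at hj ⊢
  rw [shiftTarget, if_pos (by omega), mem_shiftSet]
  exact hj

/-- If the types of resources satisfy the budget inequality of the utilities, there are games with
these resources whose efficiency is bounded by the ratio of the welfares. -/
theorem exists_game_efficiency_le (h0 : w 0 = 0) (hw : Monotone w) (y z : ι → ℕ) {β : ℝ}
    (hβ : 0 < β)
    (hf : ∑ t, z t * (f (y t + 1) : ℝ) ≤ ∑ t, ∑ k ∈ Finset.Icc 1 (y t), (f k : ℝ))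
    (hlt : β * ∑ t, w (y t) < ∑ t, w (z t)) :
    ∃ G : Game, (∀ r, G.w r = w ∧ G.f r = f) ∧ (∃ a ∈ G.jointActions, 0 < G.welfare a) ∧
      G.efficiency 1 ≤ 1 / β := by
  have hn : ∀ j, 0 ≤ w j := fun j => h0 ▸ hw (Nat.zero_le j)
  obtain ⟨K, hK⟩ : ∃ K, ∀ t, y t ≤ K :=
    ⟨Finset.univ.sup y, fun t => Finset.le_sup (Finset.mem_univ t)⟩
  obtain ⟨L, hL⟩ : ∃ L, ∀ t, z t ≤ L :=
    ⟨Finset.univ.sup z, fun t => Finset.le_sup (Finset.mem_univ t)⟩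
  set A := ∑ t, w (y t) with hA
  set B := ∑ t, w (z t) with hB
  have hA0 : 0 ≤ A := Finset.sum_nonneg fun t _ => hn _
  have hβA : 0 ≤ β * A := mul_nonneg hβ.le hA0
  -- This makes `β * (Q + K + L) * A < Q * B`: the strict gap absorbs the boundary rows.
  obtain ⟨Q, hQ⟩ := exists_nat_gt (((K + L : ℕ) : ℝ) * (β * A) / (B - β * A))
  rw [div_lt_iff₀ (by linarith)] at hQ
  have hQ0 : (0 : ℝ) < Q := by
    by_contra! h
    have h1 : (Q : ℝ) * (B - β * A) ≤ 0 := mul_nonpos_of_nonpos_of_nonneg h (by linarith)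
    have h2 : 0 ≤ ((K + L : ℕ) : ℝ) * (β * A) := by positivity
    linarith
  have hle := le_welfare_shiftTarget w f (Q + K + L) (y := y) (K := K) h0 hw hL Q rfl
  have hpos := (mul_pos hQ0 (hβA.trans_lt hlt)).trans_le hle
  refine ⟨shiftGame w f y z K (Q + K + L), fun r => ⟨rfl, rfl⟩,
    ⟨_, shiftTarget_mem w f _, hpos⟩,
    Game.efficiency_le_one_div hβ (shiftOutcome_mem_sol w f _ hK hf) (shiftTarget_mem w f _)
      hpos (le_trans ?_ hle)⟩
  rw [welfare_shiftOutcome w f _ h0 hK, ← hA, ← hB]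
  push_cast at hQ ⊢
  linarith

end ShiftGame

/-! ### The optimal guarantee -/

theorem exists_game_of_not_lpFeasible {w : WelfareRule} (h0 : w 0 = 0) (h1 : w 1 = 1)
    (hs : IsSubmodular w) (f : UtilityRule) {β : ℝ} (hβ : 0 < β)
    (hinf : ∀ F, ¬ LPFeasible w F β) :
    ∃ G : Game, (∀ r, G.w r = w ∧ G.f r = f) ∧ (∃ a ∈ G.jointActions, 0 < G.welfare a) ∧
      G.efficiency 1 ≤ 1 / β := by
  by_contra hG
  refine (not_exists.2 hinf) (exists_lpFeasible h0 h1 f hβ.le fun p q a b hab => ?_)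
  by_contra! hlt
  -- The integral weights of the dual certificate become numbers of copies of the two types.
  refine hG (exists_game_efficiency_le (ι := Fin a ⊕ Fin b) w f h0 hs.monotone
    (Sum.elim (fun _ => p.1) fun _ => q.1) (Sum.elim (fun _ => p.2) fun _ => q.2) hβ ?_ ?_)
  · simpa [Fintype.sum_sum_type] using hab
  · simpa [Fintype.sum_sum_type] using hlt

theorem nonneg_of_mem_spanned {m : ℕ} {w : Fin m → WelfareRule} (hn : ∀ l j, 0 ≤ w l j)
    {v : WelfareRule} (hv : v ∈ spanned w) (j : ℕ) : 0 ≤ v j := by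
  obtain ⟨α, rfl⟩ := hv
  rw [Finset.sum_apply]
  exact Finset.sum_nonneg fun l _ => mul_nonneg (α l).2 (hn l j)

theorem mem_spanned {m : ℕ} (w : Fin m → WelfareRule) (l : Fin m) : w l ∈ spanned w := by
  refine ⟨Pi.single l 1, ?_⟩
  rw [Finset.sum_eq_single l (fun k _ hk => by simp [Pi.single_eq_of_ne hk]) (by simp)]
  simp

theorem bddBelow_efficiency {𝒲 : Set WelfareRule} (hn : ∀ v ∈ 𝒲, ∀ j, 0 ≤ v j)
    (𝒰 : UtilityDesign 𝒲) (k : ℕ) :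
    BddBelow ((fun G : Game => G.efficiency k) '' gameClass 𝒲 𝒰) := by
  refine ⟨0, ?_⟩
  rintro _ ⟨G, hG, rfl⟩
  exact Game.efficiency_nonneg (fun r => hn _ (hG.1 r).1) k

theorem game_mem_gameClass {𝒲 : Set WelfareRule} {𝒰 : UtilityDesign 𝒲} {v : WelfareRule}
    (hv : v ∈ 𝒲) {G : Game} (hG : ∀ r, G.w r = v ∧ G.f r = 𝒰 ⟨v, hv⟩)
    (hpos : ∃ a ∈ G.jointActions, 0 < G.welfare a) : G ∈ gameClass 𝒲 𝒰 := by
  refine ⟨fun r => ?_, hpos⟩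
  obtain ⟨h1, h2⟩ := hG r
  have h3 : G.w r ∈ 𝒲 := h1 ▸ hv
  refine ⟨h3, h2.trans ?_⟩
  congr 2
  exact h1.symm

/-- No design has a better guarantee than the inverse value of the linear program of a rule of the
class. -/
theorem classEfficiency_le {𝒲 : Set WelfareRule} (hn : ∀ v ∈ 𝒲, ∀ j, 0 ≤ v j)
    (𝒰 : UtilityDesign 𝒲) {v : WelfareRule} (hv : v ∈ 𝒲) (h0 : v 0 = 0) (h1 : v 1 = 1)
    (hs : IsSubmodular v) {u : UtilityRule} {β : ℝ} (hβ : 0 < β) (hu : IsLPSolution v u β) :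
    classEfficiency 𝒲 𝒰 1 ≤ 1 / β := by
  by_contra! hlt
  have hpos : 0 < classEfficiency 𝒲 𝒰 1 := (one_div_pos.2 hβ).trans hlt
  obtain ⟨b, hb1, hb2⟩ := exists_between ((one_div_lt hβ hpos).1 hlt)
  have hb0 : 0 < b := (one_div_pos.2 hpos).trans hb1
  obtain ⟨G, hG, hGpos, hGe⟩ := exists_game_of_not_lpFeasible h0 h1 hs (𝒰 ⟨v, hv⟩) hb0
    fun F hF => absurd (hu.2 F b hF) (not_le.2 hb2)
  have hle : classEfficiency 𝒲 𝒰 1 ≤ 1 / b :=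
    (csInf_le (bddBelow_efficiency hn 𝒰 1)
      (Set.mem_image_of_mem _ (game_mem_gameClass hv hG hGpos))).trans hGe
  exact absurd hle (not_le.2 ((one_div_lt hpos hb0).1 hb1))

/-- Needed because `sInf ∅ = 0` would spoil the lower bound. Any infeasible value produces a game,
and `1 / 2` is infeasible. -/
theorem gameClass_nonempty {𝒲 : Set WelfareRule} (𝒰 : UtilityDesign 𝒲) {v : WelfareRule}
    (hv : v ∈ 𝒲) (h0 : v 0 = 0) (h1 : v 1 = 1) (hs : IsSubmodular v) :
    (gameClass 𝒲 𝒰).Nonempty := by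
  obtain ⟨G, hG, hGpos, -⟩ := exists_game_of_not_lpFeasible h0 h1 hs (𝒰 ⟨v, hv⟩)
    (β := 1 / 2) (by norm_num) fun F hF => absurd (hF.one_le h0 h1) (by norm_num)
  exact ⟨G, game_mem_gameClass hv hG hGpos⟩

theorem exists_isLinearDesign {m : ℕ} (w : Fin m → WelfareRule) (u : Fin m → UtilityRule) :
    ∃ 𝒰 : UtilityDesign (spanned w), IsLinearDesign w u 𝒰 := by
  choose α hα using fun v : spanned w => v.2
  exact ⟨fun v => ∑ l, α v l • u l, fun v => ⟨α v, hα v, rfl⟩⟩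

/-- Smoothness also meets resources unused in the outcome; at `y = 0` the inequality reduces to `w z
≤ z`. Passing to a common `b` is what permits adding the basis rules. -/
theorem LPFeasible.le_mul {w : WelfareRule} {f : UtilityRule} {β b : ℝ} (hf : LPFeasible w f β)
    (h0 : w 0 = 0) (h1 : w 1 = 1) (hs : IsSubmodular w) (hb : β ≤ b) (y z : ℕ) :
    (∑ i ∈ Finset.Icc 1 y, (f i : ℝ)) - z * (f (y + 1) : ℝ) + w z ≤ b * w y := by
  rcases Nat.eq_zero_or_pos y with rfl | hy
  · simpa [hf.2.1, h0] using hs.le_natCast h0 h1 z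
  · exact (hf.2.2 y z hy).trans (mul_le_mul_of_nonneg_right hb (hs.nonneg h0 y))

/-- Linear designs that are built from nonincreasing feasible rules guarantee the inverse of the
largest of the values. -/
theorem one_div_le_classEfficiency {m : ℕ} {w : Fin m → WelfareRule}
    (hw0 : ∀ l, w l 0 = 0) (hw1 : ∀ l, w l 1 = 1) (hsub : ∀ l, IsSubmodular (w l))
    {u : Fin m → UtilityRule} {β : Fin m → ℝ} (hu : ∀ l, LPFeasible (w l) (u l) (β l))
    (hanti : ∀ l, AntitoneOn (u l) (Set.Ici 1)) {b : ℝ} (hb0 : 0 < b) (hb : ∀ l, β l ≤ b)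
    {𝒰 : UtilityDesign (spanned w)} (h𝒰 : IsLinearDesign w u 𝒰)
    (hne : (gameClass (spanned w) 𝒰).Nonempty) :
    1 / b ≤ classEfficiency (spanned w) 𝒰 1 := by
  refine le_csInf (hne.image _) ?_
  rintro _ ⟨G, ⟨hG, hpos⟩, rfl⟩
  have hrep : ∀ r, ∃ α : Fin m → ℝ≥0, (∀ j, G.w r j = ∑ l, (α l : ℝ) * w l j) ∧
      ∀ j, G.f r j = ∑ l, α l * u l j := by
    intro r
    obtain ⟨h, hf⟩ := hG r
    obtain ⟨α, hα, hαu⟩ := h𝒰 ⟨G.w r, h⟩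
    refine ⟨α, fun j => ?_, fun j => ?_⟩
    · have := congrFun hα j
      simpa [Finset.sum_apply] using this
    · rw [hf, hαu]
      simp [Finset.sum_apply]
  refine Game.one_div_le_efficiency hb0 (fun s hs o ho =>
    Game.welfare_le_mul_welfare (fun r => ?_) (fun r => ?_) (fun r y z => ?_) hs ho) hpos
  · obtain ⟨α, hα, -⟩ := hrep r
    simp [hα, hw0]
  · obtain ⟨α, -, hα⟩ := hrep r
    intro i hi j hj hij
    rw [hα, hα]
    exact Finset.sum_le_sum fun l _ => mul_le_mul_right (hanti l hi hj hij) _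
  · obtain ⟨α, hα, hαu⟩ := hrep r
    simp only [hα, hαu]
    push_cast
    rw [Finset.sum_comm, Finset.mul_sum, Finset.mul_sum, ← Finset.sum_sub_distrib,
      ← Finset.sum_add_distrib]
    refine Finset.sum_le_sum fun l _ => ?_
    rw [← Finset.mul_sum]
    have := mul_le_mul_of_nonneg_left ((hu l).le_mul (hw0 l) (hw1 l) (hsub l) (hb l) y z)
      (α l).coe_nonneg
    linarith

end ResourceGame

open ResourceGame in
theorem theorem1 (m : ℕ) (hm : 1 ≤ m) (w : Fin m → WelfareRule)
    (hw0 : ∀ l, w l 0 = 0) (hw1 : ∀ l, w l 1 = 1) (hsub : ∀ l, IsSubmodular (w l)) :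
    ∃ β : Fin m → ℝ,
      -- the programs have optimal solutions, even nonincreasing ones, with optimal values `β l > 0`
      (∀ l, 0 < β l ∧ ∃ u : UtilityRule, IsLPSolution (w l) u (β l) ∧ AntitoneOn u (Set.Ici 1)) ∧
      -- the optimal one-round guarantee is the minimum of the numbers `1 / β l`
      IsLeast (Set.range fun l => 1 / β l) (optEfficiency (spanned w) 1) ∧
      -- linear designs built from nonincreasing optimal solutions exist, and all are optimal
      ∀ u : Fin m → UtilityRule,
        (∀ l, IsLPSolution (w l) (u l) (β l) ∧ AntitoneOn (u l) (Set.Ici 1)) →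
        (∃ 𝒰 : UtilityDesign (spanned w), IsLinearDesign w u 𝒰) ∧
        ∀ 𝒰 : UtilityDesign (spanned w), IsLinearDesign w u 𝒰 →
          classEfficiency (spanned w) 𝒰 1 = optEfficiency (spanned w) 1 := by
  choose β u hu using fun l => exists_isLPSolution (hsub l) (hw0 l) (hw1 l)
  have hβ : ∀ l, 0 < β l := fun l =>
    one_pos.trans_le ((hu l).1.1.one_le (hw0 l) (hw1 l))
  have : NeZero m := ⟨by omega⟩
  obtain ⟨k, hk⟩ := Finite.exists_max β
  have hn : ∀ v ∈ spanned w, ∀ j, 0 ≤ v j := fun v hv =>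
    nonneg_of_mem_spanned (fun l => (hsub l).nonneg (hw0 l)) hv
  have hle : ∀ 𝒰 : UtilityDesign (spanned w), ∀ l, classEfficiency (spanned w) 𝒰 1 ≤ 1 / β l :=
    fun 𝒰 l => classEfficiency_le hn 𝒰 (mem_spanned w l) (hw0 l) (hw1 l) (hsub l) (hβ l) (hu l).1
  have hlin : ∀ u' : Fin m → UtilityRule,
      (∀ l, IsLPSolution (w l) (u' l) (β l) ∧ AntitoneOn (u' l) (Set.Ici 1)) →
      ∀ 𝒰 : UtilityDesign (spanned w), IsLinearDesign w u' 𝒰 →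
        classEfficiency (spanned w) 𝒰 1 = 1 / β k := fun u' hu' 𝒰 h𝒰 =>
    le_antisymm (hle 𝒰 k) (one_div_le_classEfficiency hw0 hw1 hsub (fun l => (hu' l).1.1)
      (fun l => (hu' l).2) (hβ k) hk h𝒰
      (gameClass_nonempty 𝒰 (mem_spanned w k) (hw0 k) (hw1 k) (hsub k)))
  have hopt : optEfficiency (spanned w) 1 = 1 / β k := by
    obtain ⟨𝒰, h𝒰⟩ := exists_isLinearDesign w u
    refine IsGreatest.csSup_eq ⟨⟨𝒰, hlin u hu 𝒰 h𝒰⟩, ?_⟩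
    rintro _ ⟨𝒱, rfl⟩
    exact hle 𝒱 k
  refine ⟨β, fun l => ⟨hβ l, u l, hu l⟩, ⟨⟨k, hopt.symm⟩, ?_⟩, fun u' hu' =>
    ⟨exists_isLinearDesign w u', fun 𝒰 h𝒰 => (hlin u' hu' 𝒰 h𝒰).trans hopt.symm⟩⟩
  rintro _ ⟨l, rfl⟩
  rw [hopt]
  exact one_div_le_one_div_of_le (hβ l) (hk l)
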